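/- Let $I=\{1,\dots,n\}$, $I^*=\{1^*,\dots,n^*\}$, $J=I\cup I^*$ with the involution $i\leftrightarrow i^*$. Call $K\subseteq J$ admissible if $K\cap K^*=\emptyset$, and let $J_n$ be the set of admissible $n$-subsets of $J$. Order $J$ by $n^*<\dots<1^*<1<\dots<n$; for a permutation $w$ of $J$ commuting with $*$ put $i\leqslant^w j$ iff $w^{-1}i\leqslant w^{-1}j$, and for $A,B\in J_n$ put $A\leqslant^w B$ iff $a_k\leqslant^w b_k$ for all $k$, where $a_1<^w\dots<^w a_n$ and $b_1<^w\dots<^w b_n$ are the elements of $A$ and $B$. A *Lagrangian matroid* $M$ is given by a collection $\mathcal B\subseteq J_n$ (its *bases*) such that for every such $w$ there is $A\in\mathcal B$ with $B\leqslant^w A$ for all $B\in\mathcal B$. Let $e_1,\dots,e_n$ be the standard basis of $\mathbb R^n$, $e_{i^*}=-e_i$, and $e_A=\sum_{j\in A}e_j$. The *matroid polytope* is the convex hull of the points $e_A$, $A\in\mathcal B$; these points are its vertices, and we identify them with the bases. An edge of it with ends $A,B$ is *long* if $A=B\,\Delta\,\{i,j,i^*,j^*\}$ for some $i\neq j,j^*$.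 For a basis $F$ (the *fundamental basis*) the *height* of $A$ is $h(A)=n-|A\cap F|$; a long edge is *horizontal* if its ends have the same height, and *vertical* otherwise. A map $s_F:\mathcal B\to\{+1,-1\}$ is an *orientation of $M$ relative to $F$* if 1. $s_F(A)=s_F(B)$ whenever $A,B$ are the ends of a horizontal long edge; 2. $s_F(A)=-s_F(B)$ whenever $A,B$ are the ends of a vertical long edge; 3. if in a square 2-face $\{A,\ A\Delta\{i,i^*\},\ A\Delta\{j,j^*\},\ A\Delta\{i,j,i^*,j^*\}\}$ of the matroid polytope ($i\ne j,j^*$) three bases have one sign and the fourth has the other, then the fourth is the highest or the lowest basis of that face; 4. $s_F(F)=+1$. An *oriented Lagrangian matroid* is a Lagrangian matroid $M$ with a function $s:J_n\times J_n\to\{+1,-1,0\}$ that is $0$ if one of its arguments is not a basis, such that $s(G,\cdot)$ restricted to $\mathcal B$ is an orientation of $M$ relative to $G$ for every $G\in\mathcal B$, and $s(G,A)=s(H,A)\,s(H,G)\,(-1)^{|G\smallsetminus(H\cup A)|}$ for all $G,H,A\in\mathcal B$. An *increasing path* (with respect to $F$) from a basis $\alpha$ to a basis $\omega$ is a sequence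 of bases $\alpha=v_0,v_1,\dots,v_m=\omega$ ($m\ge 0$) such that $v_{i-1},v_i$ are the ends of an edge of the matroid polytope for $1\le i\le m$, and such that there is a linear functional $L$ on $\mathbb R^n$ which is compatible with the height ($h(A)>h(B)$ implies $L(e_A)>L(e_B)$ for all bases $A,B$) and satisfies $L(e_{v_i})>L(e_{v_{i-1}})$ for $1\le i\le m$. Its number of sign changes is the number of $i\in\{1,\dots,m\}$ with $s(F,v_{i-1})\ne s(F,v_i)$. **Theorem.** Let $(M,s)$ be an oriented Lagrangian matroid and $F$ a basis of $M$. Then the index of $M$ relative to $F$ is well defined: there is an increasing path from $F$ to some basis of maximal height relative to $F$, and all increasing paths from $F$ to bases of maximal height (any such basis, any such path) have the same number of sign changes. -/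

import Mathlib

namespace LagMat

/-- The ground set `J = I ∪ I*`, where `Sum.inl i` is `i` and `Sum.inr i` is `i*`. -/
abbrev J (n : ℕ) : Type := Fin n ⊕ Fin n

/-- The involution `j ↦ j*` of `J`. -/
def inv {n : ℕ} (j : J n) : J n := j.swap

/-- `K` is admissible when `K ∩ K* = ∅`. -/
def IsAdmissible {n : ℕ} (K : Finset (J n)) : Prop := Disjoint K (K.image inv)

/-- Admissible permutations of `J`: the elements of the hyperoctahedral group. -/
def IsAdmissiblePerm {n : ℕ} (w : Equiv.Perm (J n)) : Prop := ∀ j, w (inv j) = inv (w j)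

/-- An integer label that realises the order `n* < ⋯ < 2* < 1* < 1 < 2 < ⋯ < n` of `J`. -/
def label {n : ℕ} : J n → ℤ
  | Sum.inl i => (i : ℤ) + 1
  | Sum.inr i => -((i : ℤ) + 1)

/-- The labels of the elements of `A` for the order shifted by `w`
(`i ≤^w j` iff `w⁻¹ i ≤ w⁻¹ j`), listed increasingly. -/
def sortedLabels {n : ℕ} (w : Equiv.Perm (J n)) (A : Finset (J n)) : List ℤ :=
  (A.image fun j => label (w⁻¹ j)).sort (· ≤ ·)

/-- `A ≤^w B`: if `a₁ < ⋯ < a_k` and `b₁ < ⋯ < b_k` are the elements of `A` and `B` listed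
in the order shifted by `w`, then `a_i ≤^w b_i` for all `i`. -/
def GaleLE {n : ℕ} (w : Equiv.Perm (J n)) (A B : Finset (J n)) : Prop :=
  List.Forall₂ (· ≤ ·) (sortedLabels w A) (sortedLabels w B)

/-- Symplectic matroids of rank `k` on `J`. -/
structure SymplecticMatroid (n k : ℕ) where
  bases : Set (Finset (J n))
  admissible : ∀ A ∈ bases, IsAdmissible A
  card_eq : ∀ A ∈ bases, A.card = k
  /-- The Maximality Property. -/
  maximality : ∀ w : Equiv.Perm (J n), IsAdmissiblePerm w →
    ∃ A ∈ bases, ∀ B ∈ bases, GaleLE w B A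

/-- A Lagrangian matroid is a symplectic matroid of rank `n`. -/
abbrev LagrangianMatroid (n : ℕ) : Type := SymplecticMatroid n n

/-- The vectors `e_i` and `e_{i*} = -e_i` of `ℝⁿ`. -/
def vec {n : ℕ} : J n → (Fin n → ℝ)
  | Sum.inl i => Pi.single i 1
  | Sum.inr i => -Pi.single i 1

/-- The point `e_A = ∑_{j ∈ A} e_j`. -/
def point {n : ℕ} (A : Finset (J n)) : Fin n → ℝ := ∑ j ∈ A, vec j

/-- The matroid polytope. -/
def polytope {n : ℕ} (M : LagrangianMatroid n) : Set (Fin n → ℝ) :=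
  convexHull ℝ (point '' M.bases)

/-- The bases in `Q` span a face of the matroid polytope (faces of a polytope are its
exposed subsets). -/
def SpansFace {n : ℕ} (M : LagrangianMatroid n) (Q : Set (Finset (J n))) : Prop :=
  Q ⊆ M.bases ∧ IsExposed ℝ (polytope M) (convexHull ℝ (point '' Q))

/-- `A` and `B` are the two ends of an edge of the matroid polytope. -/
def IsEdge {n : ℕ} (M : LagrangianMatroid n) (A B : Finset (J n)) : Prop :=
  A ≠ B ∧ SpansFace M {A, B}

/-- A long edge: its ends satisfy `A = B Δ {i, j, i*, j*}` with `i ≠ j, j*`. -/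
def IsLongEdge {n : ℕ} (M : LagrangianMatroid n) (A B : Finset (J n)) : Prop :=
  IsEdge M A B ∧ ∃ i j : J n, i ≠ j ∧ i ≠ inv j ∧ A = symmDiff B {i, j, inv i, inv j}

/-- The height of `A` relative to `F`. (No truncation occurs: `|A ∩ F| ≤ n` if `|F| = n`.) -/
def height {n : ℕ} (F A : Finset (J n)) : ℕ := n - (A ∩ F).card

/-- A long edge is horizontal when its ends have the same height. -/
def IsHorizontalLongEdge {n : ℕ} (M : LagrangianMatroid n) (F A B : Finset (J n)) : Prop :=
  IsLongEdge M A B ∧ height F A = height F B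

/-- The other long edges are vertical. -/
def IsVerticalLongEdge {n : ℕ} (M : LagrangianMatroid n) (F A B : Finset (J n)) : Prop :=
  IsLongEdge M A B ∧ height F A ≠ height F B

/-- The vertices of a 2-dimensional face of the `n`-cube which is also a face of the matroid
polytope, that is, of a square face with short edges. -/
def IsShortSquare {n : ℕ} (M : LagrangianMatroid n) (Q : Set (Finset (J n))) : Prop :=
  SpansFace M Q ∧ ∃ (A : Finset (J n)) (i j : J n), i ≠ j ∧ i ≠ inv j ∧
    Q = {A, symmDiff A {i, inv i}, symmDiff A {j, inv j}, symmDiff A {i, j, inv i, inv j}}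

/-- `s` is a relative sign function on `M` with respect to the basis `F`, that is,
an orientation of `M` relative to `F`. -/
structure IsRelativeSign {n : ℕ} (M : LagrangianMatroid n) (F : Finset (J n))
    (s : Finset (J n) → SignType) : Prop where
  sign : ∀ A ∈ M.bases, s A = 1 ∨ s A = -1
  horizontal : ∀ A B, IsHorizontalLongEdge M F A B → s A = s B
  vertical : ∀ A B, IsVerticalLongEdge M F A B → s A = -s B
  square : ∀ Q, IsShortSquare M Q → ∀ X ∈ Q, (∀ Y ∈ Q, Y ≠ X → s Y = -s X) →
    (∀ Y ∈ Q, height F Y ≤ height F X) ∨ (∀ Y ∈ Q, height F X ≤ height F Y)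
  self : s F = 1

/-- Oriented Lagrangian matroids: `s G A` is the sign of `A` relative to `G`. -/
structure OrientedLagrangianMatroid (n : ℕ) where
  M : LagrangianMatroid n
  s : Finset (J n) → Finset (J n) → SignType
  zero : ∀ G A, G ∉ M.bases ∨ A ∉ M.bases → s G A = 0
  relative : ∀ G ∈ M.bases, IsRelativeSign M G (s G)
  exchange : ∀ G ∈ M.bases, ∀ H ∈ M.bases, ∀ A ∈ M.bases,
    s G A = s H A * s H G * (-1) ^ (G \ (H ∪ A)).card

/-- A linear functional on `ℝⁿ` is compatible with the height relative to `F`. -/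
def Compatible {n : ℕ} (M : LagrangianMatroid n) (F : Finset (J n))
    (L : (Fin n → ℝ) →ₗ[ℝ] ℝ) : Prop :=
  ∀ A ∈ M.bases, ∀ B ∈ M.bases, height F B < height F A → L (point B) < L (point A)

/-- Increasing paths from `α` to `ω` in the matroid polytope, with respect to the fundamental
basis `F`. The edges of the path are determined by their ends, so only the list of the
vertices is recorded. -/
structure IncreasingPath {n : ℕ} (M : LagrangianMatroid n) (F α ω : Finset (J n)) where
  length : ℕ
  vertex : Fin (length + 1) → Finset (J n)
  mem_bases : ∀ i, vertex i ∈ M.bases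
  first : vertex 0 = α
  last : vertex (Fin.last length) = ω
  edge : ∀ i : Fin length, IsEdge M (vertex i.castSucc) (vertex i.succ)
  increasing : ∃ L : (Fin n → ℝ) →ₗ[ℝ] ℝ, Compatible M F L ∧
    ∀ i : Fin length, L (point (vertex i.castSucc)) < L (point (vertex i.succ))

/-- The number of changes of the sign `σ` along a path. -/
def IncreasingPath.signChanges {n : ℕ} {M : LagrangianMatroid n} {F α ω : Finset (J n)}
    (p : IncreasingPath M F α ω) (σ : Finset (J n) → SignType) : ℕ :=
  (Finset.univ.filter fun i : Fin p.length =>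
    σ (p.vertex i.castSucc) ≠ σ (p.vertex i.succ)).card

/-- `ω` is a basis of maximal height relative to `F`. -/
def IsMaxHeight {n : ℕ} (M : LagrangianMatroid n) (F ω : Finset (J n)) : Prop :=
  ω ∈ M.bases ∧ ∀ A ∈ M.bases, height F A ≤ height F ω

end LagMat

/-!
Relative to the fundamental basis `F`, a basis is recorded by the set `S` of coordinates in which it
differs from `F`, so that its height is `|S|` and the sign `s(F, ·)` becomes a function `g` of
finite sets, extended by zero to the non-bases. The model is the sign of the principal minors `det X_S` of
a real symmetric matrix, where the index is the number of negative eigenvalues of `X`.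

Two properties of `g` are needed. Its support is a delta-matroid: the maximality property implies
symmetric exchange (`LagMat.symmetric_exchange`). And, writing `S+i` for `S ∪ {i}`, the sign
conditions amount to the inequality `g S * g (S+i+j) ≤ g (S+i) * g (S+j)`
(`LagMat.isOrientedDelta_relSign`).

These properties survive the combinatorial analogue of adding a small positive number to a diagonal
entry of `X` (`LagMat.IsOrientedDelta.perturb`). After all diagonal entries are perturbed, `g` has
no zeros (`LagMat.IsOrientedDelta.exists_extension`), its values on bases being unchanged. The
inequality then says that both monotone paths around a square of the Boolean lattice have equally
many sign changes, so that the number of sign changes along a chain from `∅` to `S` depends on `S`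
only (`LagMat.exists_potential`). This number `ν S` is the index of `S`.

The edges of the matroid polytope flip one or two coordinates
(`LagMat.IsEdge.eq_singleton_or_pair`), and along each edge that does not descend, `ν` grows by one
if the sign changes and stays constant otherwise (`LagMat.potential_step`). Hence an increasing path
from `F` to `ω` has `ν ω - ν F` sign changes, whatever its functional is. The bases of maximal
height form a matroid, and basis exchanges preserve `ν`
(`LagMat.IsOrientedDelta.eq_of_card_maximal`), so the number does not depend on `ω`. An increasing
path exists because a basis that is not of maximal height is the lower end of an edge that raises
the height (`LagMat.IsOrientedDelta.exists_augment`).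
-/

namespace LagMat

open Finset

/-! ### Oriented delta-matroids and their perturbations -/

section Combinatorics
variable {α : Type*} [DecidableEq α]

/-- The support of `g` satisfies the symmetric exchange axiom of a delta-matroid, and the signs
satisfy the inequality obeyed by the signs of the principal minors of a real symmetric matrix,
where `det X_{S+i} * det X_{S+j} - det X_S * det X_{S+i+j}` is a square. This single inequality
expresses the sign conditions on vertical long edges, horizontal long edges and squares. -/
structure IsOrientedDelta (g : Finset α → SignType) : Prop where
  exchange : ∀ A B, g A ≠ 0 → g B ≠ 0 → ∀ i ∈ symmDiff A B,
    ∃ j ∈ symmDiff A B, g (symmDiff A {i, j}) ≠ 0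
  mul_le_mul : ∀ S i j, i ∉ S → j ∉ S → i ≠ j →
    g S * g (insert i (insert j S)) ≤ g (insert i S) * g (insert j S)

/-- If `g S` is the sign of the principal minor `det X_S` of a symmetric matrix `X`, then
`perturb k g S` is the sign of that minor after a small positive number is added to the `k`-th
diagonal entry. -/
def perturb (k : α) (g : Finset α → SignType) (S : Finset α) : SignType :=
  if g S = 0 ∧ k ∈ S then g (S.erase k) else g S

set_option synthInstance.maxSize 2000 in
set_option synthInstance.maxHeartbeats 200000 in
/-- The inequality of `IsOrientedDelta` for the perturbed values, on a square all of whose sets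
contain the perturbed element `k`. It is a finite check over the eight signs of a 3-cube: its
hypotheses are the inequality on the six faces and the exchange axiom for antipodal vertices.
A variable `ij` stands for the sign of the base set enlarged by `i` and `j`, and `a` for that of
the base set itself. -/
theorem perturb_sign_ineq : ∀ a k i ki : SignType, a * ki ≤ k * i →
    ∀ j kj : SignType, a * kj ≤ k * j → ∀ ij : SignType, a * ij ≤ i * j →
    ∀ kij : SignType, k * kij ≤ ki * kj ∧ i * kij ≤ ki * ij ∧ j * kij ≤ kj * ij →
    (k ≠ 0 → ij ≠ 0 → (ki ≠ 0 ∨ i ≠ 0 ∨ kij ≠ 0) ∧ (kj ≠ 0 ∨ j ≠ 0 ∨ kij ≠ 0)) ∧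
    (ki ≠ 0 → j ≠ 0 → (k ≠ 0 ∨ a ≠ 0 ∨ kj ≠ 0) ∧ (kij ≠ 0 ∨ ij ≠ 0 ∨ kj ≠ 0)) ∧
    (kj ≠ 0 → i ≠ 0 → (k ≠ 0 ∨ a ≠ 0 ∨ ki ≠ 0) ∧ (kij ≠ 0 ∨ ij ≠ 0 ∨ ki ≠ 0)) ∧
    (kij ≠ 0 → a ≠ 0 → (kj ≠ 0 ∨ j ≠ 0 ∨ k ≠ 0) ∧ (ki ≠ 0 ∨ i ≠ 0 ∨ k ≠ 0)) →
    (if k = 0 then a else k) * (if kij = 0 then ij else kij) ≤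
      (if ki = 0 then i else ki) * (if kj = 0 then j else kj) := by
  decide +kernel

theorem perturb_of_notMem {k : α} {g : Finset α → SignType} {S : Finset α} (h : k ∉ S) :
    perturb k g S = g S := by simp [perturb, h]

theorem perturb_insert {k : α} {g : Finset α → SignType} {S : Finset α} (h : k ∉ S) :
    perturb k g (insert k S) = if g (insert k S) = 0 then g S else g (insert k S) := by
  simp [perturb, h]

theorem perturb_ne_zero_iff {k : α} {g : Finset α → SignType} {S : Finset α} :
    perturb k g S ≠ 0 ↔ g S ≠ 0 ∨ (k ∈ S ∧ g (S.erase k) ≠ 0) := by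
  unfold perturb; split_ifs <;> grind

/-- Symmetric exchange between antipodal vertices of a 3-cube. -/
theorem IsOrientedDelta.exchange_triple {g : Finset α → SignType} (h : IsOrientedDelta g)
    {A B C : Finset α} {i j k : α} (hB : B = symmDiff A {i, j, k}) (hA0 : g A ≠ 0) (hB0 : g B ≠ 0)
    {D E : Finset α} (hC : C = symmDiff A {i}) (hD : D = symmDiff A {i, j})
    (hE : E = symmDiff A {i, k}) : g C ≠ 0 ∨ g D ≠ 0 ∨ g E ≠ 0 := by
  subst hB
  have hAB : symmDiff A (symmDiff A {i, j, k}) = {i, j, k} := symmDiff_symmDiff_cancel_left _ _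
  obtain ⟨l, hl, hl0⟩ := h.exchange A _ hA0 hB0 i (by rw [hAB]; simp)
  rw [hAB] at hl
  simp only [mem_insert, mem_singleton] at hl
  rcases hl with rfl | rfl | rfl
  · left; rw [hC]; simpa using hl0
  · right; left; rwa [hD]
  · right; right; rwa [hE]

/-- If no set of the square contains `k`, nothing changes. If `k` is one of its two directions, the
inequality for the perturbed signs follows from that for `g` on the same square. If all its sets
contain `k`, the square is a facet of a 3-cube with third direction `k`. -/
theorem IsOrientedDelta.perturb_mul_le_mul {g : Finset α → SignType} (h : IsOrientedDelta g)
    (k : α) {S : Finset α} {i j : α} (hi : i ∉ S) (hj : j ∉ S) (hij : i ≠ j) :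
    perturb k g S * perturb k g (insert i (insert j S)) ≤
      perturb k g (insert i S) * perturb k g (insert j S) := by
  by_cases hkS : k ∈ S
  · obtain ⟨R, hkR, rfl⟩ : ∃ R, k ∉ R ∧ insert k R = S :=
      ⟨S.erase k, by simp, insert_erase hkS⟩
    have hik : i ≠ k := by rintro rfl; simp at hi
    have hjk : j ≠ k := by rintro rfl; simp at hj
    have hiR : i ∉ R := fun h => hi (mem_insert_of_mem h)
    have hjR : j ∉ R := fun h => hj (mem_insert_of_mem h)
    have e1 : insert i (insert k R) = insert k (insert i R) := insert_comm ..
    have e2 : insert j (insert k R) = insert k (insert j R) := insert_comm ..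
    have e3 : insert i (insert k (insert j R)) = insert k (insert i (insert j R)) :=
      insert_comm ..
    have e4 : insert j (insert i R) = insert i (insert j R) := insert_comm ..
    rw [e2, e3, e1, perturb_insert hkR, perturb_insert (by grind),
      perturb_insert (by grind), perturb_insert (by grind)]
    have m1 := h.mul_le_mul R k i hkR hiR hik.symm
    have m2 := h.mul_le_mul R k j hkR hjR hjk.symm
    have m3 := h.mul_le_mul R i j hiR hjR hij
    have m4 := h.mul_le_mul (insert k R) i j hi hj hij
    have m5 := h.mul_le_mul (insert i R) k j (by grind) (by grind) hjk.symm
    have m6 := h.mul_le_mul (insert j R) k i (by grind) (by grind) hik.symm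
    rw [e2, e3, e1] at m4
    rw [e4] at m5
    refine perturb_sign_ineq _ _ _ _ m1 _ _ m2 _ m3 _ ⟨m4, m5, m6⟩
      ⟨fun h1 h2 => ⟨?_, ?_⟩, fun h1 h2 => ⟨?_, ?_⟩, fun h1 h2 => ⟨?_, ?_⟩,
        fun h1 h2 => ⟨?_, ?_⟩⟩
    · refine h.exchange_triple (i := i) (j := k) (k := j) ?_ h1 h2 ?_ ?_ ?_ <;>
        grind [mem_symmDiff]
    · refine h.exchange_triple (i := j) (j := k) (k := i) ?_ h1 h2 ?_ ?_ ?_ <;>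
        grind [mem_symmDiff]
    · refine h.exchange_triple (i := i) (j := k) (k := j) ?_ h1 h2 ?_ ?_ ?_ <;>
        grind [mem_symmDiff]
    · refine h.exchange_triple (i := j) (j := k) (k := i) ?_ h1 h2 ?_ ?_ ?_ <;>
        grind [mem_symmDiff]
    · refine h.exchange_triple (i := j) (j := k) (k := i) ?_ h1 h2 ?_ ?_ ?_ <;>
        grind [mem_symmDiff]
    · refine h.exchange_triple (i := i) (j := k) (k := j) ?_ h1 h2 ?_ ?_ ?_ <;>
        grind [mem_symmDiff]
    · refine h.exchange_triple (i := i) (j := k) (k := j) ?_ h1 h2 ?_ ?_ ?_ <;>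
        grind [mem_symmDiff]
    · refine h.exchange_triple (i := j) (j := k) (k := i) ?_ h1 h2 ?_ ?_ ?_ <;>
        grind [mem_symmDiff]
  · have key : ∀ a b c d : SignType, a * d ≤ b * c →
        a * (if d = 0 then c else d) ≤ (if b = 0 then a else b) * c := by decide
    have m := h.mul_le_mul S i j hi hj hij
    by_cases hki : k = i
    · subst hki
      rw [perturb_of_notMem hkS, perturb_of_notMem (S := insert j S) (by grind),
        perturb_insert hkS, perturb_insert (by grind)]
      exact key _ _ _ _ m
    · by_cases hkj : k = j
      · subst hkj
        rw [insert_comm, perturb_of_notMem hkS, perturb_of_notMem (S := insert i S) (by grind),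
          perturb_insert hkS, perturb_insert (by grind)]
        rw [insert_comm, mul_comm (g (insert i S)) (g (insert k S))] at m
        rw [mul_comm (g (insert i S)) (ite _ _ _)]
        exact key _ _ _ _ m
      · rw [perturb_of_notMem hkS, perturb_of_notMem (by grind), perturb_of_notMem (by grind),
          perturb_of_notMem (by grind)]
        exact m

theorem IsOrientedDelta.perturb_exchange {g : Finset α → SignType} (h : IsOrientedDelta g)
    (k : α) {A B : Finset α} (hA : perturb k g A ≠ 0) (hB : perturb k g B ≠ 0) {i : α}
    (hi : i ∈ symmDiff A B) :
    ∃ j ∈ symmDiff A B, perturb k g (symmDiff A {i, j}) ≠ 0 := by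
  simp only [perturb_ne_zero_iff] at *
  rcases hA with hA | ⟨hkA, hA⟩
  · rcases hB with hB | ⟨hkB, hB⟩
    · obtain ⟨j, hj, hj0⟩ := h.exchange A B hA hB i hi
      exact ⟨j, hj, Or.inl hj0⟩
    · by_cases hik : i = k
      · refine ⟨i, hi, Or.inr ⟨by grind [mem_symmDiff], ?_⟩⟩
        convert hA using 2
        grind [mem_symmDiff]
      · obtain ⟨j, hj, hj0⟩ := h.exchange A _ hA hB i (by grind [mem_symmDiff])
        by_cases hjk : j = k
        · refine ⟨i, hi, Or.inr ⟨by grind [mem_symmDiff], ?_⟩⟩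
          convert hj0 using 2
          grind [mem_symmDiff]
        · exact ⟨j, by grind [mem_symmDiff], Or.inl hj0⟩
  · rcases hB with hB | ⟨hkB, hB⟩
    · by_cases hik : i = k
      · refine ⟨i, hi, Or.inl ?_⟩
        convert hA using 2
        grind [mem_symmDiff]
      · obtain ⟨j, hj, hj0⟩ := h.exchange _ B hA hB i (by grind [mem_symmDiff])
        by_cases hjk : j = k
        · refine ⟨i, hi, Or.inl ?_⟩
          convert hj0 using 2
          grind [mem_symmDiff]
        · refine ⟨j, by grind [mem_symmDiff], Or.inr ⟨by grind [mem_symmDiff], ?_⟩⟩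
          convert hj0 using 2
          grind [mem_symmDiff]
    · obtain ⟨j, hj, hj0⟩ := h.exchange _ _ hA hB i (by grind [mem_symmDiff])
      refine ⟨j, by grind [mem_symmDiff], Or.inr ⟨by grind [mem_symmDiff], ?_⟩⟩
      convert hj0 using 2
      grind [mem_symmDiff]

theorem IsOrientedDelta.perturb {g : Finset α → SignType} (h : IsOrientedDelta g) (k : α) :
    IsOrientedDelta (perturb k g) :=
  ⟨fun _ _ hA hB _ hi => h.perturb_exchange k hA hB hi,
    fun _ _ _ hi hj hij => h.perturb_mul_le_mul k hi hj hij⟩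

/-- Perturbing all diagonal entries one after the other removes every zero, since `g ∅ ≠ 0`. -/
theorem IsOrientedDelta.exists_extension {g : Finset α → SignType} (h : IsOrientedDelta g)
    (h0 : g ∅ ≠ 0) (U : Finset α) : ∃ g' : Finset α → SignType, IsOrientedDelta g' ∧
      (∀ S, g S ≠ 0 → g' S = g S) ∧ ∀ S ⊆ U, g' S ≠ 0 := by
  induction U using Finset.induction_on with
  | empty => exact ⟨g, h, fun _ _ => rfl, fun S hS => by rwa [subset_empty.1 hS]⟩
  | insert u U hu ih =>
    obtain ⟨g', h', heq, hne⟩ := ih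
    refine ⟨LagMat.perturb u g', h'.perturb u, fun S hS => ?_, fun S hS => ?_⟩
    · simp [LagMat.perturb, heq S hS, hS]
    · rw [perturb_ne_zero_iff]
      by_cases huS : u ∈ S
      · exact Or.inr ⟨huS, hne _ (subset_insert_iff.1 hS)⟩
      · exact Or.inl (hne _ ((subset_insert_iff_of_notMem huS).1 hS))

/-! ### The index of an oriented delta-matroid -/

/-- Without zeros, the inequality says that the two monotone paths around a square have the same
number of sign changes; hence the number of sign changes along a chain of sets is a function of
the ends of the chain. -/
theorem exists_potential (g : Finset α → SignType) (hg : ∀ S, g S ≠ 0)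
    (h : ∀ S i j, i ∉ S → j ∉ S → i ≠ j →
    g S * g (insert i (insert j S)) ≤ g (insert i S) * g (insert j S)) (U : Finset α) :
    ∃ ν : Finset α → ℕ, ∀ S ⊆ U, ∀ i ∈ U, i ∉ S →
      ν (insert i S) = ν S + if g S ≠ g (insert i S) then 1 else 0 := by
  have key : ∀ a b c d : SignType, a ≠ 0 → b ≠ 0 → c ≠ 0 → d ≠ 0 → a * d ≤ b * c →
      (if a ≠ b then 1 else 0) + (if b ≠ d then 1 else 0) =
      (if a ≠ c then 1 else 0) + (if c ≠ d then 1 else 0) := by decide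
  induction U using Finset.induction_on with
  | empty => exact ⟨fun _ => 0, by simp⟩
  | insert u U hu ih =>
    obtain ⟨ν, hν⟩ := ih
    refine ⟨fun S => if u ∈ S then ν (S.erase u) + (if g (S.erase u) ≠ g S then 1 else 0)
      else ν S, ?_⟩
    intro S hS i hi hiS
    by_cases hiu : i = u
    · subst hiu
      simp [hiS]
    · have hiU : i ∈ U := (mem_insert.1 hi).resolve_left hiu
      by_cases huS : u ∈ S
      · obtain ⟨R, huR, rfl⟩ : ∃ R, u ∉ R ∧ insert u R = S :=
          ⟨S.erase u, by simp, insert_erase huS⟩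
        have hRU : R ⊆ U := fun x hx => (mem_insert.1 (hS (mem_insert_of_mem hx))).resolve_left
          (by rintro rfl; exact huR hx)
        have hiR : i ∉ R := fun h => hiS (mem_insert_of_mem h)
        have e : (insert i (insert u R)).erase u = insert i R := by
          rw [insert_comm, erase_insert]; simp [Ne.symm hiu, huR]
        have := hν R hRU i hiU hiR
        have := key _ _ _ _ (hg R) (hg (insert i R)) (hg (insert u R))
          (hg (insert i (insert u R))) (h R i u hiR huR hiu)
        simp only [mem_insert_self, mem_insert_of_mem, if_true, e, erase_insert huR]
        omega
      · have : u ∉ insert i S := by simp [Ne.symm hiu, huS]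
        simp only [this, huS, if_false]
        exact hν S (fun x hx => (mem_insert.1 (hS hx)).resolve_left
          (by rintro rfl; exact huS hx)) i hiU hiS

theorem symmDiff_pair_of_notMem {S : Finset α} {i j : α} (hi : i ∉ S) (hj : j ∉ S) :
    symmDiff S {i, j} = insert i (insert j S) := by
  ext x; simp only [mem_symmDiff, mem_insert, mem_singleton]; grind

theorem symmDiff_insert_pair {S : Finset α} {i j : α} (hi : i ∉ S) (hj : j ∉ S) (hij : i ≠ j) :
    symmDiff (insert j S) {i, j} = insert i S := by
  ext x; simp only [mem_symmDiff, mem_insert, mem_singleton]; grind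

/-- A set of the support that is not of maximal size can be enlarged by one or two elements. (The
two elements may coincide.) -/
theorem IsOrientedDelta.exists_augment {g : Finset α → SignType} (h : IsOrientedDelta g)
    {S B : Finset α} (hS : g S ≠ 0) (hB : g B ≠ 0) (hlt : S.card < B.card) :
    ∃ i j, i ∉ S ∧ j ∉ S ∧ g (insert i (insert j S)) ≠ 0 := by
  induction hd : (S \ B).card using Nat.strong_induction_on generalizing B with
  | _ d ih =>
    by_cases hSB : S ⊆ B
    · obtain ⟨i, hiB, hiS⟩ := exists_mem_notMem_of_card_lt_card hlt
      obtain ⟨j, hj, hj0⟩ := h.exchange S B hS hB i (by grind [mem_symmDiff])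
      have hjS : j ∉ S := by grind [mem_symmDiff]
      refine ⟨i, j, hiS, hjS, ?_⟩
      rwa [symmDiff_pair_of_notMem hiS hjS] at hj0
    · -- replace `B` by a set that is closer to `S` and not smaller
      obtain ⟨i, hiS, hiB⟩ := not_subset.1 hSB
      obtain ⟨j, hj, hj0⟩ := h.exchange B S hB hS i (by grind [mem_symmDiff])
      -- flipping `i ∈ S \ B` and at most one further element of `B ∆ S` keeps `B` large
      have hle : B.card ≤ (symmDiff B {i, j}).card := by
        have h1 : insert i (B.erase j) ⊆ symmDiff B {i, j} := by grind [mem_symmDiff]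
        have h2 := card_le_card h1
        rw [card_insert_of_notMem (by grind)] at h2
        have := pred_card_le_card_erase (s := B) (a := j)
        omega
      refine ih (S \ symmDiff B {i, j}).card ?_ hj0 (hlt.trans_le hle) rfl
      rw [← hd]
      refine card_lt_card ⟨fun x hx => ?_, fun h' => ?_⟩
      · simp only [mem_sdiff, mem_symmDiff, mem_insert, mem_singleton] at hx hj ⊢
        grind
      · have := h' (mem_sdiff.2 ⟨hiS, hiB⟩)
        simp [mem_symmDiff, hiB] at this

/-- `ν` behaves along the edges of an oriented delta-matroid as the number of negative eigenvalues
of a principal submatrix does: adding an element counts a sign change, a long vertical edge counts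
one, a long horizontal edge counts none. -/
structure IsIndexFunction (g : Finset α → SignType) (ν : Finset α → ℕ) : Prop where
  insert_one : ∀ S i, i ∉ S → g S ≠ 0 → g (insert i S) ≠ 0 →
    ν (insert i S) = ν S + if g S ≠ g (insert i S) then 1 else 0
  insert_two : ∀ S i j, i ∉ S → j ∉ S → i ≠ j → g S ≠ 0 → g (insert i (insert j S)) ≠ 0 →
    g S = -g (insert i (insert j S)) → ν (insert i (insert j S)) = ν S + 1
  horizontal : ∀ S i j, i ∉ S → j ∉ S → i ≠ j → g (insert i S) ≠ 0 →
    g (insert i S) = g (insert j S) → ν (insert i S) = ν (insert j S)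

/-- The index function is read off an extension of `g` without zeros: a path through sets on which
`g` vanishes contributes the same number of sign changes as the long edge that bypasses them. -/
theorem IsOrientedDelta.exists_index [Fintype α] {g : Finset α → SignType}
    (h : IsOrientedDelta g) (h0 : g ∅ ≠ 0) : ∃ ν, IsIndexFunction g ν := by
  obtain ⟨g', h', heq, hne⟩ := h.exists_extension h0 univ
  obtain ⟨ν, hν⟩ := exists_potential g' (fun S => hne S (subset_univ S)) h'.mul_le_mul univ
  have hν' : ∀ S i, i ∉ S → ν (insert i S) = ν S + if g' S ≠ g' (insert i S) then 1 else 0 :=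
    fun S i hi => hν S (subset_univ S) i (mem_univ i) hi
  refine ⟨ν, ?_, ?_, ?_⟩
  · intro S i hi hS hiS
    rw [hν' S i hi, heq _ hS, heq _ hiS]
  · intro S i j hi hj hij hS hijS hs
    have key : ∀ a b c : SignType, a ≠ 0 → b ≠ 0 → a = -c →
      (if a ≠ b then 1 else 0) + (if b ≠ c then 1 else 0) = 1 := by decide
    rw [hν' _ i (by grind), hν' S j hj, add_assoc,
      key _ _ _ (hne _ (subset_univ _)) (hne _ (subset_univ _))]
    rw [heq _ hS, heq _ hijS, hs]
  · intro S i j hi hj hij hiS hs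
    rw [hν' S i hi, hν' S j hj, heq _ hiS, heq (insert j S) (by rwa [← hs]), hs]

/-- The index is the same for all maximal sets of the support: these are the bases of a matroid, so
any two are joined by basis exchanges, and every exchange is a horizontal long edge because no
larger set lies in the support. -/
theorem IsOrientedDelta.eq_of_card_maximal {g : Finset α → SignType}
    (h : IsOrientedDelta g) {ν : Finset α → ℕ} (hν : IsIndexFunction g ν)
    {A B : Finset α} (hA : g A ≠ 0) (hB : g B ≠ 0) (hAm : ∀ S, g S ≠ 0 → S.card ≤ A.card)
    (hBm : ∀ S, g S ≠ 0 → S.card ≤ B.card) : ν A = ν B := by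
  induction hd : (B \ A).card using Nat.strong_induction_on generalizing A with
  | _ d ih =>
    have hcard : A.card = B.card := le_antisymm (hBm A hA) (hAm B hB)
    by_cases hBA : B ⊆ A
    · rw [eq_of_subset_of_card_le hBA hcard.le]
    · obtain ⟨i, hiB, hiA⟩ := not_subset.1 hBA
      obtain ⟨j, hj, hj0⟩ := h.exchange A B hA hB i (by grind [mem_symmDiff])
      have hjA : j ∈ A := by
        by_contra hjA
        have e := symmDiff_pair_of_notMem hiA hjA
        have h1 := hAm _ hj0
        have h2 : (insert i A).card ≤ (insert i (insert j A)).card := card_le_card (by grind)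
        rw [card_insert_of_notMem hiA] at h2
        rw [e] at h1
        omega
      obtain ⟨R, hjR, rfl⟩ : ∃ R, j ∉ R ∧ insert j R = A :=
        ⟨A.erase j, by simp, insert_erase hjA⟩
      have hij : i ≠ j := by grind
      have hiR : i ∉ R := by grind
      rw [symmDiff_insert_pair hiR hjR hij] at hj0
      have hc : (insert i R).card = (insert j R).card := by
        rw [card_insert_of_notMem hiR, card_insert_of_notMem hjR]
      have hbig : g (insert i (insert j R)) = 0 := by
        by_contra h0
        have := hAm _ h0
        rw [card_insert_of_notMem hiA] at this
        omega
      have key : ∀ a b : SignType, a ≠ 0 → b ≠ 0 → 0 ≤ a * b → a = b := by decide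
      have hs : g (insert i R) = g (insert j R) := by
        refine key _ _ hj0 hA ?_
        have := h.mul_le_mul R i j hiR hjR hij
        rwa [hbig, mul_zero] at this
      rw [← hν.horizontal R i j hiR hjR hij hj0 hs]
      refine ih _ ?_ hj0 (fun S hS => (hAm S hS).trans hc.ge) rfl
      rw [← hd]
      refine card_lt_card ⟨fun x hx => ?_, fun h' => ?_⟩
      · simp only [mem_sdiff, mem_symmDiff, mem_insert] at hx hj ⊢
        grind
      · have := h' (mem_sdiff.2 ⟨hiB, hiA⟩)
        simp at this

end Combinatorics

/-! ### Bases as vertices of the cube, and symmetric exchange -/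

section Cube
variable {n : ℕ}

/-- The vertex of the cube `[-1, 1]ⁿ` with positive coordinates `P`, as an admissible `n`-subset of
`J`: it contains `i` for `i ∈ P` and `i*` for `i ∉ P`. -/
def cubeVertex (P : Finset (Fin n)) : Finset (J n) := P.disjSum Pᶜ

theorem inl_mem_cubeVertex {P : Finset (Fin n)} {k : Fin n} :
    Sum.inl k ∈ cubeVertex P ↔ k ∈ P := by simp [cubeVertex]

theorem inr_mem_cubeVertex {P : Finset (Fin n)} {k : Fin n} :
    Sum.inr k ∈ cubeVertex P ↔ k ∉ P := by simp [cubeVertex]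

theorem cubeVertex_injective : Function.Injective (cubeVertex (n := n)) := by
  intro P Q h
  ext k
  rw [← inl_mem_cubeVertex, h, inl_mem_cubeVertex]

theorem card_cubeVertex (P : Finset (Fin n)) : (cubeVertex P).card = n := by
  rw [cubeVertex, card_disjSum, card_add_card_compl, Fintype.card_fin]

theorem exists_eq_cubeVertex {A : Finset (J n)} (hA : IsAdmissible A) (hc : A.card = n) :
    ∃ P, A = cubeVertex P := by
  refine ⟨univ.filter fun k => Sum.inl k ∈ A, eq_of_subset_of_card_le ?_ ?_⟩
  · rintro (k | k) hk
    · simpa [inl_mem_cubeVertex] using hk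
    · rw [inr_mem_cubeVertex, mem_filter]
      rintro ⟨-, hk'⟩
      exact disjoint_left.1 hA hk (mem_image.2 ⟨_, hk', rfl⟩)
  · rw [card_cubeVertex, hc]

theorem symmDiff_cubeVertex_one (P : Finset (Fin n)) (a : Fin n) :
    symmDiff (cubeVertex P) {Sum.inl a, inv (Sum.inl a)} = cubeVertex (symmDiff P {a}) := by
  ext (k | k)
  · simp [mem_symmDiff, inl_mem_cubeVertex, inv]
  · simp [mem_symmDiff, inr_mem_cubeVertex, inv]
    tauto

theorem symmDiff_cubeVertex_two (P : Finset (Fin n)) (a b : Fin n) :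
    symmDiff (cubeVertex P) {Sum.inl a, Sum.inl b, inv (Sum.inl a), inv (Sum.inl b)} =
      cubeVertex (symmDiff P {a, b}) := by
  ext (k | k)
  · simp [mem_symmDiff, inl_mem_cubeVertex, inv]
  · simp [mem_symmDiff, inr_mem_cubeVertex, inv]
    tauto

/-- The height is the Hamming distance of the cube vertices. -/
theorem height_cubeVertex (P Q : Finset (Fin n)) :
    height (cubeVertex P) (cubeVertex Q) = (symmDiff Q P).card := by
  have h1 : cubeVertex Q ∩ cubeVertex P = (Q ∩ P).disjSum (Qᶜ ∩ Pᶜ) := by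
    ext (k | k) <;> simp [inl_mem_cubeVertex, inr_mem_cubeVertex]
  have h2 : (Q ∩ P) ∪ (Qᶜ ∩ Pᶜ) = (symmDiff Q P)ᶜ := by
    ext k
    simp only [mem_union, mem_inter, mem_compl, mem_symmDiff]
    tauto
  have h3 : Disjoint (Q ∩ P) (Qᶜ ∩ Pᶜ) := by
    rw [disjoint_left]; intro k; simp; tauto
  have h4 := card_add_card_compl (symmDiff Q P)
  rw [height, h1, card_disjSum, ← card_union_of_disjoint h3, h2]
  rw [Fintype.card_fin] at h4
  omega

end Cube

section Exchange
variable {n : ℕ}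

theorem countP_le_of_forall₂ {l₁ l₂ : List ℤ} (h : List.Forall₂ (· ≤ ·) l₁ l₂) (t : ℤ) :
    l₁.countP (t ≤ ·) ≤ l₂.countP (t ≤ ·) := by
  induction h with
  | nil => simp
  | cons hab _ ih =>
    simp only [List.countP_cons, decide_eq_true_eq]
    split_ifs <;> omega

theorem label_injective : Function.Injective (label (n := n)) := by
  rintro (i | i) (j | j) h <;> simp only [label] at h
  · congr 1; apply Fin.ext; omega
  · omega
  · omega
  · congr 1; apply Fin.ext; omega

theorem countP_sortedLabels (w : Equiv.Perm (J n)) (A : Finset (J n)) (t : ℤ) :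
    (sortedLabels w A).countP (t ≤ ·) = (A.filter fun j => t ≤ label (w⁻¹ j)).card := by
  have hinj : Function.Injective fun j => label (w⁻¹ j) :=
    label_injective.comp (w⁻¹).injective
  rw [← card_image_of_injective (A.filter _) hinj]
  rw [sortedLabels, ← Multiset.coe_countP, sort_eq, Multiset.countP_eq_card_filter, ← filter_val,
    card_val]
  congr 1
  ext x
  simp only [mem_filter, mem_image]
  grind

/-- The involution of `J` that stars the elements whose index lies outside `R`. -/
def starOutside (R : Finset (Fin n)) (j : J n) : J n :=
  if Sum.elim id id j ∈ R then j else inv j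

theorem starOutside_involutive (R : Finset (Fin n)) : Function.Involutive (starOutside R) := by
  rintro (k | k) <;> by_cases h : k ∈ R <;> simp [starOutside, inv, h]

/-- The admissible permutation that stars the indices outside `R` and then permutes the indices
by `σ`. Its inverse defines the order on `J` in which `cubeVertex R` has the positive labels and
index `k` has absolute label `σ k + 1`. -/
def signedPerm (σ : Equiv.Perm (Fin n)) (R : Finset (Fin n)) : Equiv.Perm (J n) :=
  ((starOutside_involutive R).toPerm).trans (Equiv.sumCongr σ σ)

theorem signedPerm_inv_admissible (σ : Equiv.Perm (Fin n)) (R : Finset (Fin n)) :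
    IsAdmissiblePerm (signedPerm σ R)⁻¹ := by
  intro j
  rw [Equiv.Perm.inv_eq_iff_eq]
  obtain ⟨x, rfl⟩ := (signedPerm σ R).surjective j
  rw [show (signedPerm σ R)⁻¹ (signedPerm σ R x) = x from (signedPerm σ R).symm_apply_apply x]
  rcases x with (k | k) <;> by_cases h : k ∈ R <;> simp [signedPerm, starOutside, inv, h]

theorem card_filter_label_signedPerm (σ : Equiv.Perm (Fin n)) (R Z : Finset (Fin n)) (m : ℕ) :
    ((cubeVertex Z).filter fun j => (m : ℤ) + 1 ≤ label (signedPerm σ R j)).card =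
      (univ.filter fun k => k ∉ symmDiff Z R ∧ m ≤ (σ k : ℕ)).card := by
  refine card_bij (fun j _ => Sum.elim id id j) ?_ ?_ ?_
  · rintro (k | k) hk <;> by_cases h : k ∈ R <;>
      simp [inl_mem_cubeVertex, inr_mem_cubeVertex, signedPerm, starOutside, inv, h, label,
        mem_symmDiff] at hk ⊢ <;> grind
  · rintro (k | k) hk (l | l) hl hkl <;> by_cases h : k ∈ R <;>
      simp [inl_mem_cubeVertex, inr_mem_cubeVertex, signedPerm, starOutside, inv, h,
        label] at hk hl hkl ⊢ <;>
      grind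
  · intro k hk
    simp only [mem_filter, mem_univ, true_and, mem_symmDiff] at hk
    by_cases h : k ∈ R
    · refine ⟨Sum.inl k, ?_, rfl⟩
      simp [inl_mem_cubeVertex, signedPerm, starOutside, h, label]
      grind
    · refine ⟨Sum.inr k, ?_, rfl⟩
      simp [inr_mem_cubeVertex, signedPerm, starOutside, h, label, inv]
      grind

/-- The maximality property for the order given by `σ` and `R`, in terms of coordinates: some basis
has, for every `m`, the most coordinates in common with `cubeVertex R` among the indices ranked
`m` or higher. -/
theorem exists_maximal (M : LagrangianMatroid n) (σ : Equiv.Perm (Fin n)) (R : Finset (Fin n)) :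
    ∃ Y, cubeVertex Y ∈ M.bases ∧ ∀ Z, cubeVertex Z ∈ M.bases → ∀ m : ℕ,
      (univ.filter fun k => k ∉ symmDiff Z R ∧ m ≤ (σ k : ℕ)).card ≤
        (univ.filter fun k => k ∉ symmDiff Y R ∧ m ≤ (σ k : ℕ)).card := by
  obtain ⟨A, hA, hmax⟩ := M.maximality _ (signedPerm_inv_admissible σ R)
  obtain ⟨Y, rfl⟩ := exists_eq_cubeVertex (M.admissible A hA) (M.card_eq A hA)
  refine ⟨Y, hA, fun Z hZ m => ?_⟩
  have := countP_le_of_forall₂ (hmax _ hZ) ((m : ℤ) + 1)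
  rwa [countP_sortedLabels, countP_sortedLabels, inv_inv, card_filter_label_signedPerm,
    card_filter_label_signedPerm] at this

theorem exists_perm_lt_of_lt (f : Fin n → ℕ) :
    ∃ σ : Equiv.Perm (Fin n), ∀ k l, f k < f l → σ k < σ l := by
  refine ⟨(Tuple.sort f).symm, fun k l h => ?_⟩
  by_contra! h'
  have := Tuple.monotone_sort f h'
  simp only [Function.comp_apply, Equiv.apply_symm_apply] at this
  omega

/-- Symmetric exchange. Apply maximality to the reference vertex `R = P ∆ {i}`, ranking the
coordinates where `P` and `Q` agree highest, then `i`, then the rest. Comparison with `P` and `Q`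
shows that the maximal basis agrees with `R` on the two higher groups, and comparison with `P`
shows that it differs from `R` in at most one coordinate. -/
theorem symmetric_exchange (M : LagrangianMatroid n) {P Q : Finset (Fin n)}
    (hP : cubeVertex P ∈ M.bases) (hQ : cubeVertex Q ∈ M.bases) {i : Fin n}
    (hi : i ∈ symmDiff P Q) :
    ∃ j ∈ symmDiff P Q, cubeVertex (symmDiff P {i, j}) ∈ M.bases := by
  obtain ⟨σ, hσ⟩ := exists_perm_lt_of_lt
    fun k : Fin n => if k ∈ symmDiff P Q then if k = i then 1 else 0 else 2
  set R := symmDiff P {i} with hR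
  obtain ⟨Y, hY, hmax⟩ := exists_maximal M σ R
  -- if all coordinates from `m` on agree with `R` for a basis `Z`, they do so for `Y`
  have full : ∀ Z, cubeVertex Z ∈ M.bases → ∀ l, (∀ k, σ l ≤ σ k → k ∉ symmDiff Z R) →
      l ∉ symmDiff Y R := by
    intro Z hZ l hl
    have h1 := hmax Z hZ (σ l)
    have h2 : (univ.filter fun k => k ∉ symmDiff Z R ∧ (σ l : ℕ) ≤ (σ k : ℕ)) =
        univ.filter fun k => (σ l : ℕ) ≤ (σ k : ℕ) :=
      filter_congr fun k _ => ⟨fun h => h.2, fun h => ⟨hl k h, h⟩⟩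
    rw [h2] at h1
    have h3 := eq_of_subset_of_card_le (fun k hk => by
      rw [mem_filter] at hk ⊢; exact ⟨hk.1, hk.2.2⟩) h1
    have h4 : l ∈ univ.filter fun k => (σ l : ℕ) ≤ (σ k : ℕ) := by simp
    rw [← h3, mem_filter] at h4
    exact h4.2.1
  have hsub : ∀ k ∈ symmDiff Y R, k ∈ symmDiff P Q ∧ k ≠ i := by
    intro k hk
    have hkD : k ∈ symmDiff P Q := by
      by_contra hkD
      refine full P hP k (fun l hl hl' => ?_) hk
      have hli : l = i := by grind [mem_symmDiff]
      subst hli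
      exact absurd (hσ l k (by simp [hi, hkD])) (not_lt.2 hl)
    refine ⟨hkD, ?_⟩
    rintro rfl
    refine full Q hQ k (fun l hl hl' => ?_) hk
    have hl1 : l ∈ symmDiff P Q ∧ l ≠ k := by grind [mem_symmDiff]
    exact absurd (hσ l k (by simp [hl1.1, hl1.2, hi])) (not_lt.2 hl)
  have hcard : (symmDiff Y R).card ≤ 1 := by
    have h1 := hmax P hP 0
    have h2 : (univ.filter fun k => k ∉ symmDiff P R ∧ 0 ≤ (σ k : ℕ)) = {i}ᶜ := by
      ext k; simp only [hR, symmDiff_symmDiff_cancel_left]; simp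
    have h3 : (univ.filter fun k => k ∉ symmDiff Y R ∧ 0 ≤ (σ k : ℕ)) = (symmDiff Y R)ᶜ := by
      ext k; simp only [mem_filter, mem_compl, mem_univ, true_and, Nat.zero_le, and_true]
    rw [h2, h3] at h1
    have h4 := card_add_card_compl (symmDiff Y R)
    have h5 := card_add_card_compl ({i} : Finset (Fin n))
    rw [card_singleton] at h5
    omega
  have : Nonempty (Fin n) := ⟨i⟩
  rcases card_le_one_iff_subset_singleton.1 hcard with ⟨j, hj⟩
  rcases subset_singleton_iff.1 hj with h0 | h1
  · refine ⟨i, hi, ?_⟩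
    have : Y = R := symmDiff_eq_bot.1 h0
    rw [this, hR] at hY
    simpa using hY
  · have hj' := hsub j (by simp [h1])
    refine ⟨j, hj'.1, ?_⟩
    convert hY using 2
    rw [← symmDiff_symmDiff_cancel_right R Y, h1, hR]
    grind [mem_symmDiff]

end Exchange

/-! ### Faces of the matroid polytope -/

section Exposed

/-- If `Q` consists of the points of `V` where `l` attains its maximum `c` over `V`, then the convex
hull of `Q` consists of the points of the convex hull of `V` where `l` equals `c`. -/
theorem mem_convexHull_of_le_of_eq {E : Type*} [AddCommGroup E] [Module ℝ E] {V Q : Set E}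
    (l : E →ₗ[ℝ] ℝ) {c : ℝ} (hV : ∀ v ∈ V, l v < c ∨ (l v = c ∧ v ∈ Q)) {x : E}
    (hx : x ∈ convexHull ℝ V) : l x < c ∨ (l x = c ∧ x ∈ convexHull ℝ Q) := by
  refine convexHull_min (t := {x | l x < c ∨ (l x = c ∧ x ∈ convexHull ℝ Q)}) ?_ ?_ hx
  · intro v hv
    exact (hV v hv).imp id fun h => ⟨h.1, subset_convexHull ℝ Q h.2⟩
  · rw [convex_iff_forall_pos]
    intro x hx y hy a b ha hb hab
    have hl : l (a • x + b • y) = a * l x + b * l y := by simp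
    simp only [Set.mem_ofPred_eq, hl]
    have hc : c = a * c + b * c := by rw [← add_mul, hab, one_mul]
    rcases hx with hx | ⟨hx, hxQ⟩
    · left
      have : l y ≤ c := hy.elim le_of_lt fun h => h.1.le
      nlinarith
    · rcases hy with hy | ⟨hy, hyQ⟩
      · left; nlinarith
      · right
        exact ⟨by rw [hx, hy, ← hc], convex_convexHull ℝ Q hxQ hyQ ha.le hb.le hab⟩

theorem isExposed_convexHull {E : Type*} [AddCommGroup E] [Module ℝ E] [TopologicalSpace E]
    {V Q : Set E} (hQV : Q ⊆ V) (l : E →L[ℝ] ℝ) {c : ℝ} (hQ : ∀ v ∈ Q, l v = c)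
    (hV : ∀ v ∈ V, l v < c ∨ (l v = c ∧ v ∈ Q)) :
    IsExposed ℝ (convexHull ℝ V) (convexHull ℝ Q) := by
  rintro ⟨q, hq⟩
  have key := fun {x : E} (hx : x ∈ convexHull ℝ V) =>
    mem_convexHull_of_le_of_eq (l : E →ₗ[ℝ] ℝ) hV hx
  have hQc : ∀ x ∈ convexHull ℝ Q, l x = c := fun x hx => by
    have : convexHull ℝ Q ⊆ {x | l x = c} :=
      convexHull_min hQ (convex_hyperplane (f := l) (l : E →ₗ[ℝ] ℝ).isLinear c)
    exact this hx
  refine ⟨l, Set.Subset.antisymm (fun x hx => ⟨convexHull_mono hQV hx, fun y hy => ?_⟩) ?_⟩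
  · rw [hQc x hx]
    exact (key hy).elim le_of_lt fun h => h.1.le
  · rintro x ⟨hx, hmax⟩
    refine (key hx).elim (fun h => ?_) fun h => h.2
    have h1 := hmax q (convexHull_mono hQV hq)
    rw [hQc q hq] at h1
    exact absurd h (not_lt.2 h1)

end Exposed

section Faces
variable {n : ℕ}

/-- The coordinates of the cube vertex with positive coordinates `P`. -/
def sgn (P : Finset (Fin n)) (k : Fin n) : ℝ := if k ∈ P then 1 else -1

theorem sgn_mul_self (P : Finset (Fin n)) (k : Fin n) : sgn P k * sgn P k = 1 := by
  unfold sgn; split_ifs <;> norm_num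

theorem point_cubeVertex (P : Finset (Fin n)) : point (cubeVertex P) = sgn P := by
  ext k
  simp only [point, cubeVertex, sum_disjSum, vec, Finset.sum_apply, Pi.neg_apply,
    Pi.single_apply, sum_neg_distrib, sum_ite_eq, mem_compl, sgn]
  by_cases h : k ∈ P <;> simp [h]

theorem point_cubeVertex_symmDiff (P T : Finset (Fin n)) :
    point (cubeVertex (symmDiff P T)) =
      point (cubeVertex P) - ∑ k ∈ T, (2 * sgn P k) • Pi.single k (1 : ℝ) := by
  rw [point_cubeVertex, point_cubeVertex]
  ext k
  simp only [sgn, mem_symmDiff, Pi.sub_apply, Finset.sum_apply, Pi.smul_apply, Pi.single_apply,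
    smul_eq_mul, mul_ite, mul_one, mul_zero, sum_ite_eq]
  by_cases hP : k ∈ P <;> by_cases hT : k ∈ T <;> simp [hP, hT] <;> norm_num

theorem apply_point_cubeVertex_symmDiff (L : (Fin n → ℝ) →ₗ[ℝ] ℝ) (P T : Finset (Fin n)) :
    L (point (cubeVertex (symmDiff P T))) =
      L (point (cubeVertex P)) - 2 * ∑ k ∈ T, sgn P k * L (Pi.single k 1) := by
  simp [point_cubeVertex_symmDiff, map_sub, map_sum, mul_sum, mul_assoc]

/-- Linear functionals on the cube in coordinates centred at a vertex: flipping the coordinate `k`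
costs twice the weight `w k`. -/
theorem exists_functional (P : Finset (Fin n)) (w : Fin n → ℝ) :
    ∃ L : (Fin n → ℝ) →L[ℝ] ℝ, ∀ T, L (point (cubeVertex (symmDiff P T))) =
      L (point (cubeVertex P)) - 2 * ∑ k ∈ T, w k := by
  let L : (Fin n → ℝ) →L[ℝ] ℝ :=
    ∑ k, (sgn P k * w k) • ContinuousLinearMap.proj (R := ℝ) (φ := fun _ : Fin n => ℝ) k
  refine ⟨L, fun T => ?_⟩
  have hL : ∀ k, L (Pi.single k 1) = sgn P k * w k := fun k => by
    simp [L, Pi.single_apply]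
  have := apply_point_cubeVertex_symmDiff (L : (Fin n → ℝ) →ₗ[ℝ] ℝ) P T
  simp only [ContinuousLinearMap.coe_coe, hL] at this
  rw [this]
  congr 2
  refine sum_congr rfl fun k _ => ?_
  rw [← mul_assoc, sgn_mul_self, one_mul]

theorem exists_eq_cubeVertex_symmDiff {M : LagrangianMatroid n} {A : Finset (J n)}
    (hA : A ∈ M.bases) (P : Finset (Fin n)) : ∃ T, A = cubeVertex (symmDiff P T) := by
  obtain ⟨Q, rfl⟩ := exists_eq_cubeVertex (M.admissible A hA) (M.card_eq A hA)
  exact ⟨symmDiff P Q, by rw [symmDiff_symmDiff_cancel_left]⟩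

theorem spansFace_of_weight {M : LagrangianMatroid n} (P : Finset (Fin n)) (w : Fin n → ℝ)
    {Q : Set (Finset (J n))} (hQM : Q ⊆ M.bases)
    (hQ : ∀ T, cubeVertex (symmDiff P T) ∈ Q → ∑ k ∈ T, w k = 0)
    (hM : ∀ T, cubeVertex (symmDiff P T) ∈ M.bases → cubeVertex (symmDiff P T) ∉ Q →
      0 < ∑ k ∈ T, w k) : SpansFace M Q := by
  obtain ⟨L, hL⟩ := exists_functional P w
  refine ⟨hQM, isExposed_convexHull (Set.image_mono hQM) L (c := L (point (cubeVertex P)))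
    ?_ ?_⟩
  · rintro _ ⟨A, hA, rfl⟩
    obtain ⟨T, rfl⟩ := exists_eq_cubeVertex_symmDiff (hQM hA) P
    rw [hL, hQ T hA]; ring
  · rintro _ ⟨A, hA, rfl⟩
    obtain ⟨T, rfl⟩ := exists_eq_cubeVertex_symmDiff hA P
    by_cases hAQ : cubeVertex (symmDiff P T) ∈ Q
    · right
      exact ⟨by rw [hL, hQ T hAQ]; ring, Set.mem_image_of_mem _ hAQ⟩
    · left
      have := hM T hA hAQ
      rw [hL]; linarith

/-- The bases in a face of the cube span a face of the matroid polytope. -/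
theorem spansFace_cubeFace {M : LagrangianMatroid n} (P D : Finset (Fin n))
    {Q : Set (Finset (J n))} (hQM : Q ⊆ M.bases)
    (hQ : ∀ T, cubeVertex (symmDiff P T) ∈ Q → T ⊆ D)
    (hM : ∀ T ⊆ D, cubeVertex (symmDiff P T) ∈ M.bases → cubeVertex (symmDiff P T) ∈ Q) :
    SpansFace M Q := by
  refine spansFace_of_weight P (fun k => if k ∈ D then 0 else 1) hQM (fun T hT => ?_)
    fun T hT hTQ => ?_
  · exact sum_eq_zero fun k hk => if_pos (hQ T hT hk)
  · obtain ⟨k, hkT, hkD⟩ := not_subset.1 fun h => hTQ (hM T h hT)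
    refine sum_pos' (fun k _ => by split_ifs <;> norm_num) ⟨k, hkT, by simp [hkD]⟩

theorem cubeVertex_symmDiff_inj {P T T' : Finset (Fin n)} :
    cubeVertex (symmDiff P T) = cubeVertex (symmDiff P T') ↔ T = T' :=
  cubeVertex_injective.eq_iff.trans (symmDiff_right_injective P).eq_iff

theorem cubeVertex_symmDiff_eq_self {P T : Finset (Fin n)} :
    cubeVertex (symmDiff P T) = cubeVertex P ↔ T = ∅ := by
  rw [cubeVertex_injective.eq_iff]; exact symmDiff_eq_left

theorem isEdge_one {M : LagrangianMatroid n} {P : Finset (Fin n)} {i : Fin n}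
    (hP : cubeVertex P ∈ M.bases) (hi : cubeVertex (symmDiff P {i}) ∈ M.bases) :
    IsEdge M (cubeVertex P) (cubeVertex (symmDiff P {i})) := by
  refine ⟨fun h => by simpa using cubeVertex_symmDiff_eq_self.1 h.symm,
    spansFace_cubeFace P {i} ?_ ?_ ?_⟩
  · rintro A (rfl | rfl) <;> assumption
  · rintro T (h | h)
    · simp [cubeVertex_symmDiff_eq_self.1 h]
    · rw [cubeVertex_symmDiff_inj.1 h]
  · intro T hT _
    rcases subset_singleton_iff.1 hT with rfl | rfl
    · exact Or.inl (cubeVertex_symmDiff_eq_self.2 rfl)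
    · exact Or.inr rfl

/-- The diagonal of a square face of the cube is an edge of the matroid polytope unless all four
vertices are bases. -/
theorem isEdge_two {M : LagrangianMatroid n} {P : Finset (Fin n)} {i j : Fin n} (hij : i ≠ j)
    (hP : cubeVertex P ∈ M.bases) (hPij : cubeVertex (symmDiff P {i, j}) ∈ M.bases)
    (h : cubeVertex (symmDiff P {i}) ∉ M.bases ∨ cubeVertex (symmDiff P {j}) ∉ M.bases) :
    IsEdge M (cubeVertex P) (cubeVertex (symmDiff P {i, j})) := by
  wlog hj : cubeVertex (symmDiff P {j}) ∉ M.bases generalizing i j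
  · have := this hij.symm (by rwa [pair_comm]) h.symm (h.resolve_right hj)
    rwa [pair_comm] at this
  have hne : ({i, j} : Finset (Fin n)) ≠ ∅ := by simp
  refine ⟨fun h => hne (cubeVertex_symmDiff_eq_self.1 h.symm), ?_⟩
  -- the weights vanish on `{i, j}`, and among the subsets of `{i, j}` are negative only on `{j}`
  set w : Fin n → ℝ := fun k => if k = i then 1 else if k = j then -1 else 2 with hw
  have hsum : ∀ T : Finset (Fin n), ∑ k ∈ T, w k =
      (if i ∈ T then 1 else 0) - (if j ∈ T then 1 else 0) + 2 * ((T \ {i, j}).card : ℝ) := by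
    intro T
    have h1 : ∀ k, w k = (if k = i then 1 else 0) - (if k = j then 1 else 0) +
        2 * (if k ∈ ({i, j} : Finset (Fin n)) then 0 else 1) := by
      intro k
      by_cases hki : k = i
      · subst hki; simp [hw, hij]
      · by_cases hkj : k = j
        · subst hkj; simp [hw, hki]
        · simp [hw, hki, hkj]
    simp_rw [h1, sum_add_distrib, sum_sub_distrib, ← mul_sum, sum_ite_eq']
    congr 2
    rw [sum_ite, sum_const_zero, zero_add, sum_const, nsmul_one, sdiff_eq_filter]
  refine spansFace_of_weight P w ?_ ?_ ?_
  · rintro A (rfl | rfl) <;> assumption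
  · rintro T (h | h)
    · simp [cubeVertex_symmDiff_eq_self.1 h]
    · rw [cubeVertex_symmDiff_inj.1 h, hsum]; simp
  · intro T hT hTQ
    rw [hsum]
    have hT0 : T ≠ ∅ := by
      rintro rfl; exact hTQ (Or.inl (cubeVertex_symmDiff_eq_self.2 rfl))
    have hTij : T ≠ {i, j} := by rintro rfl; exact hTQ (Or.inr rfl)
    have hTj : T ≠ {j} := by rintro rfl; exact hj hT
    by_cases hD : T ⊆ {i, j}
    · have hi : i ∈ T := by
        by_contra hi
        have : T ⊆ {j} := fun k hk => by
          have := hD hk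
          simp only [mem_insert, mem_singleton] at this ⊢
          exact this.resolve_left (by rintro rfl; exact hi hk)
        rcases subset_singleton_iff.1 this with h | h
        · exact hT0 h
        · exact hTj h
      have hj : j ∉ T := fun hj => hTij (hD.antisymm (by
        intro k hk
        simp only [mem_insert, mem_singleton] at hk
        rcases hk with rfl | rfl <;> assumption))
      simp only [hi, hj, if_true, if_false]
      positivity
    · have : 1 ≤ (T \ {i, j}).card := card_pos.2 (sdiff_nonempty.2 hD)
      have : (1 : ℝ) ≤ ((T \ {i, j}).card : ℝ) := by exact_mod_cast this
      split_ifs <;> linarith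

theorem eq_or_eq_of_point_mem_segment {P Q R : Finset (Fin n)}
    (h : point (cubeVertex R) ∈ segment ℝ (point (cubeVertex P)) (point (cubeVertex Q))) :
    R = P ∨ R = Q := by
  simp only [point_cubeVertex] at h
  obtain ⟨a, b, ha, hb, hab, h⟩ := h
  have hk : ∀ k, a * sgn P k + b * sgn Q k = sgn R k := fun k => congrFun h k
  by_cases hb0 : b = 0
  · left
    ext k
    have := hk k
    have ha1 : a = 1 := by linarith
    rw [hb0, ha1] at this
    simp only [sgn] at this
    by_contra hne
    split_ifs at this <;> first | (exfalso; linarith) | tauto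
  by_cases ha0 : a = 0
  · right
    ext k
    have := hk k
    have hb1 : b = 1 := by linarith
    rw [ha0, hb1] at this
    simp only [sgn] at this
    by_contra hne
    split_ifs at this <;> first | (exfalso; linarith) | tauto
  left
  have ha' : 0 < a := lt_of_le_of_ne ha (Ne.symm ha0)
  have hb' : 0 < b := lt_of_le_of_ne hb (Ne.symm hb0)
  ext k
  have := hk k
  simp only [sgn] at this
  by_contra hne
  split_ifs at this <;> first | (exfalso; linarith) | tauto

/-- A functional that exposes an edge, written as flipping costs at one end of the edge. -/
theorem IsEdge.exists_weight {M : LagrangianMatroid n} {P T₀ : Finset (Fin n)}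
    (h : IsEdge M (cubeVertex P) (cubeVertex (symmDiff P T₀))) :
    ∃ w : Fin n → ℝ, ∑ k ∈ T₀, w k = 0 ∧ ∀ T, cubeVertex (symmDiff P T) ∈ M.bases →
      ∑ k ∈ T, w k ≤ 0 → T = ∅ ∨ T = T₀ := by
  obtain ⟨-, hsub, hexp⟩ := h
  rw [Set.image_pair, convexHull_pair] at hexp
  obtain ⟨l, hl⟩ := hexp ⟨_, left_mem_segment ..⟩
  have hP := hl.subset (left_mem_segment ..)
  have hQ := hl.subset (right_mem_segment ..)
  have hLT := apply_point_cubeVertex_symmDiff (l : (Fin n → ℝ) →ₗ[ℝ] ℝ) P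
  simp only [ContinuousLinearMap.coe_coe] at hLT
  refine ⟨fun k => sgn P k * l (Pi.single k 1), ?_, fun T hT hT0 => ?_⟩
  · have h1 := hP.2 _ hQ.1
    have h2 := hQ.2 _ hP.1
    have := hLT T₀
    linarith
  · have hmem : point (cubeVertex (symmDiff P T)) ∈
        segment ℝ (point (cubeVertex P)) (point (cubeVertex (symmDiff P T₀))) := by
      rw [hl]
      refine ⟨subset_convexHull ℝ _ (Set.mem_image_of_mem _ hT), fun y hy => ?_⟩
      refine (hP.2 y hy).trans ?_
      rw [hLT]
      linarith
    rcases eq_or_eq_of_point_mem_segment hmem with h | h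
    · left; exact symmDiff_eq_left.1 h
    · right; exact symmDiff_right_injective P h

/-- The ends of an edge differ in at most two coordinates (`i = j` is allowed). Otherwise an
exchange between them yields a third basis on which the exposing functional is at least as large. -/
theorem IsEdge.eq_singleton_or_pair {M : LagrangianMatroid n} {P T : Finset (Fin n)}
    (h : IsEdge M (cubeVertex P) (cubeVertex (symmDiff P T))) : ∃ i j, T = {i, j} := by
  obtain ⟨w, hw0, hw⟩ := h.exists_weight
  have hT : T.Nonempty := by
    rw [nonempty_iff_ne_empty]
    rintro rfl
    exact h.1 (cubeVertex_symmDiff_eq_self.2 rfl).symm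
  have hP : cubeVertex P ∈ M.bases := h.2.1 (by simp)
  have hPT : cubeVertex (symmDiff P T) ∈ M.bases := h.2.1 (by simp)
  -- exchange at an element of largest absolute weight, starting from the end at which flipping it
  -- does not cost anything; no second flip can outweigh the gain
  obtain ⟨i, hi, hmax⟩ := exists_max_image T (fun k => |w k|) hT
  have hpair : ∀ j, ∑ k ∈ ({i, j} : Finset (Fin n)), w k = w i ∨
      ∑ k ∈ ({i, j} : Finset (Fin n)), w k = w i + w j := fun j => by
    by_cases hij : i = j
    · left; simp [hij]
    · right; exact sum_pair hij
  rcases le_total (w i) 0 with hwi | hwi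
  · obtain ⟨j, hj, hb⟩ := symmetric_exchange M hP hPT (i := i) (by simpa using hi)
    rw [symmDiff_symmDiff_cancel_left] at hj
    have hle : ∑ k ∈ ({i, j} : Finset (Fin n)), w k ≤ 0 := by
      have h1 := hmax j hj
      rw [abs_of_nonpos hwi] at h1
      have h2 := le_abs_self (w j)
      rcases hpair j with h | h <;> linarith
    rcases hw _ hb hle with h | h
    · simp at h
    · exact ⟨i, j, h.symm⟩
  · obtain ⟨j, hj, hb⟩ := symmetric_exchange M hPT hP (i := i) (by
      rwa [symmDiff_comm, symmDiff_symmDiff_cancel_left])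
    rw [symmDiff_comm, symmDiff_symmDiff_cancel_left] at hj
    have hsub : ({i, j} : Finset (Fin n)) ⊆ T := by
      simp [insert_subset_iff, hi, hj]
    rw [symmDiff_assoc, symmDiff_of_ge hsub] at hb
    have hle : ∑ k ∈ T \ {i, j}, w k ≤ 0 := by
      have h1 := hmax j hj
      rw [abs_of_nonneg hwi] at h1
      have h2 := neg_abs_le (w j)
      have h3 := sum_sdiff (f := w) hsub
      rcases hpair j with h | h <;> linarith
    refine ⟨i, j, (hsub.antisymm ?_).symm⟩
    rcases hw _ hb hle with h | h
    · exact sdiff_eq_empty_iff_subset.1 h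
    · exact absurd (h.ge hi) (by simp)

end Faces

/-! ### Signs relative to a fundamental basis, and increasing paths -/

section Relative
variable {n : ℕ}

/-- The sign of a basis relative to the fundamental basis `cubeVertex P`, as a function of the set
`S` of coordinates in which the two differ; the height of the basis is `|S|`. -/
def relSign (O : OrientedLagrangianMatroid n) (P S : Finset (Fin n)) : SignType :=
  O.s (cubeVertex P) (cubeVertex (symmDiff P S))

variable {O : OrientedLagrangianMatroid n} {P : Finset (Fin n)}

theorem relSign_ne_zero_iff (hP : cubeVertex P ∈ O.M.bases) {S : Finset (Fin n)} :
    relSign O P S ≠ 0 ↔ cubeVertex (symmDiff P S) ∈ O.M.bases := by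
  refine ⟨fun h => by_contra fun h' => h (O.zero _ _ (Or.inr h')), fun h => ?_⟩
  rcases (O.relative _ hP).sign _ h with h | h <;> rw [relSign, h] <;> decide

theorem height_cubeVertex_symmDiff (P S : Finset (Fin n)) :
    height (cubeVertex P) (cubeVertex (symmDiff P S)) = S.card := by
  rw [height_cubeVertex, symmDiff_comm, symmDiff_symmDiff_cancel_left]

theorem isLongEdge_of_isEdge {M : LagrangianMatroid n} {Q Q' : Finset (Fin n)} {i j : Fin n}
    (hij : i ≠ j) (hQ : Q' = symmDiff Q {i, j}) (h : IsEdge M (cubeVertex Q) (cubeVertex Q')) :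
    IsLongEdge M (cubeVertex Q) (cubeVertex Q') := by
  refine ⟨h, Sum.inl i, Sum.inl j, by simpa using hij, by simp [inv], ?_⟩
  rw [symmDiff_cubeVertex_two, hQ, symmDiff_symmDiff_cancel_right]

theorem relSign_eq_neg (hP : cubeVertex P ∈ O.M.bases) {S : Finset (Fin n)} {i j : Fin n}
    (hi : i ∉ S) (hj : j ∉ S) (hij : i ≠ j)
    (h : IsEdge O.M (cubeVertex (symmDiff P S))
      (cubeVertex (symmDiff P (insert i (insert j S))))) :
    relSign O P S = -relSign O P (insert i (insert j S)) := by
  refine (O.relative _ hP).vertical _ _ ⟨isLongEdge_of_isEdge hij ?_ h, ?_⟩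
  · rw [symmDiff_assoc, symmDiff_pair_of_notMem hi hj]
  · rw [height_cubeVertex_symmDiff, height_cubeVertex_symmDiff,
      card_insert_of_notMem (by simp [hij, hi]), card_insert_of_notMem hj]
    omega

theorem relSign_eq (hP : cubeVertex P ∈ O.M.bases) {S : Finset (Fin n)} {i j : Fin n}
    (hi : i ∉ S) (hj : j ∉ S) (hij : i ≠ j)
    (h : IsEdge O.M (cubeVertex (symmDiff P (insert j S)))
      (cubeVertex (symmDiff P (insert i S)))) :
    relSign O P (insert j S) = relSign O P (insert i S) := by
  refine (O.relative _ hP).horizontal _ _ ⟨isLongEdge_of_isEdge hij ?_ h, ?_⟩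
  · rw [symmDiff_assoc, symmDiff_insert_pair hi hj hij]
  · rw [height_cubeVertex_symmDiff, height_cubeVertex_symmDiff,
      card_insert_of_notMem hi, card_insert_of_notMem hj]

theorem symmDiff_singleton_of_notMem {α : Type*} [DecidableEq α] {S : Finset α} {i : α}
    (hi : i ∉ S) : symmDiff S {i} = insert i S := by
  ext x; simp only [mem_symmDiff, mem_insert, mem_singleton]; grind

/-- In a square of bases, the sign at a vertex of middle height is not opposite to all others. -/
theorem relSign_square (hP : cubeVertex P ∈ O.M.bases) {S : Finset (Fin n)} {i j : Fin n}
    (hi : i ∉ S) (hj : j ∉ S) (hij : i ≠ j) (h0 : relSign O P S ≠ 0)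
    (h1 : relSign O P (insert i S) ≠ 0) (h2 : relSign O P (insert j S) ≠ 0)
    (h3 : relSign O P (insert i (insert j S)) ≠ 0) :
    ¬ (relSign O P S = -relSign O P (insert i S) ∧
      relSign O P (insert j S) = -relSign O P (insert i S) ∧
      relSign O P (insert i (insert j S)) = -relSign O P (insert i S)) := by
  rintro ⟨e0, e2, e3⟩
  rw [relSign_ne_zero_iff hP] at h0 h1 h2 h3
  set Q : Set (Finset (J n)) := {cubeVertex (symmDiff P S), cubeVertex (symmDiff P (insert i S)),
    cubeVertex (symmDiff P (insert j S)), cubeVertex (symmDiff P (insert i (insert j S)))}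
    with hQ
  have hQM : Q ⊆ O.M.bases := by
    rintro A (rfl | rfl | rfl | rfl) <;> assumption
  have hQ' : Q = {cubeVertex (symmDiff P S), cubeVertex (symmDiff (symmDiff P S) {i}),
      cubeVertex (symmDiff (symmDiff P S) {j}), cubeVertex (symmDiff (symmDiff P S) {i, j})} := by
    rw [symmDiff_assoc, symmDiff_assoc, symmDiff_assoc, symmDiff_singleton_of_notMem hi,
      symmDiff_singleton_of_notMem hj, symmDiff_pair_of_notMem hi hj]
  have hmem : ∀ T, cubeVertex (symmDiff (symmDiff P S) T) ∈ Q ↔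
      T = ∅ ∨ T = {i} ∨ T = {j} ∨ T = {i, j} := by
    intro T
    simp only [hQ', Set.mem_insert_iff, Set.mem_singleton_iff, cubeVertex_symmDiff_inj,
      cubeVertex_symmDiff_eq_self]
  have hface : IsShortSquare O.M Q := by
    refine ⟨spansFace_cubeFace (symmDiff P S) {i, j} hQM ?_ ?_, cubeVertex (symmDiff P S),
      Sum.inl i, Sum.inl j, by simpa using hij, by simp [inv], ?_⟩
    · intro T hT
      rcases (hmem T).1 hT with rfl | rfl | rfl | rfl <;> simp
    · intro T hT _
      rw [hmem]
      by_cases hiT : i ∈ T <;> by_cases hjT : j ∈ T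
      · right; right; right
        exact hT.antisymm (by simp [insert_subset_iff, hiT, hjT])
      · right; left
        exact (Nonempty.subset_singleton_iff ⟨i, hiT⟩).1 fun x hx => by
          have := hT hx
          grind
      · right; right; left
        exact (Nonempty.subset_singleton_iff ⟨j, hjT⟩).1 fun x hx => by
          have := hT hx
          grind
      · left
        exact eq_empty_of_forall_notMem fun x hx => by
          have := hT hx
          grind
    · rw [hQ', symmDiff_cubeVertex_one, symmDiff_cubeVertex_one, symmDiff_cubeVertex_two]
  have hext := (O.relative _ hP).square Q hface (cubeVertex (symmDiff P (insert i S)))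
    (by simp [hQ]) (by
      rintro A (rfl | rfl | rfl | rfl) hne
      · exact e0
      · exact absurd rfl hne
      · exact e2
      · exact e3)
  have c1 : (insert i S).card = S.card + 1 := card_insert_of_notMem hi
  have c2 : (insert i (insert j S)).card = S.card + 2 := by
    rw [card_insert_of_notMem (by simp [hij, hi]), card_insert_of_notMem hj]
  rcases hext with h | h
  · have := h (cubeVertex (symmDiff P (insert i (insert j S)))) (by simp [hQ])
    rw [height_cubeVertex_symmDiff, height_cubeVertex_symmDiff] at this
    omega
  · have := h (cubeVertex (symmDiff P S)) (by simp [hQ])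
    rw [height_cubeVertex_symmDiff, height_cubeVertex_symmDiff] at this
    omega

/-- The conditions on a relative sign function amount to the inequality of `IsOrientedDelta`: if one
diagonal of a square is not contained in the set of bases, then the other one, if it is, is a long
edge. -/
theorem isOrientedDelta_relSign (hP : cubeVertex P ∈ O.M.bases) :
    IsOrientedDelta (relSign O P) := by
  refine ⟨fun A B hA hB i hi => ?_, fun S i j hi hj hij => ?_⟩
  · rw [relSign_ne_zero_iff hP] at hA hB
    have e : symmDiff (symmDiff P A) (symmDiff P B) = symmDiff A B := by
      rw [symmDiff_comm P A, symmDiff_assoc, symmDiff_symmDiff_cancel_left]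
    obtain ⟨j, hj, hb⟩ := symmetric_exchange O.M hA hB (i := i) (by rwa [e])
    refine ⟨j, by rwa [e] at hj, ?_⟩
    rwa [relSign_ne_zero_iff hP, ← symmDiff_assoc]
  · have b0 := relSign_ne_zero_iff hP (S := S)
    have b1 := relSign_ne_zero_iff hP (S := insert i S)
    have b2 := relSign_ne_zero_iff hP (S := insert j S)
    have b3 := relSign_ne_zero_iff hP (S := insert i (insert j S))
    by_cases h03 : relSign O P S ≠ 0 ∧ relSign O P (insert i (insert j S)) ≠ 0
    · obtain ⟨h0, h3⟩ := h03
      by_cases h12 : relSign O P (insert i S) ≠ 0 ∧ relSign O P (insert j S) ≠ 0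
      · obtain ⟨h1, h2⟩ := h12
        have key : ∀ a b c d : SignType, a ≠ 0 → b ≠ 0 → c ≠ 0 → d ≠ 0 →
          ¬ (a = -b ∧ c = -b ∧ d = -b) → ¬ (a = -c ∧ b = -c ∧ d = -c) → a * d ≤ b * c := by
          decide
        refine key _ _ _ _ h0 h1 h2 h3 (relSign_square hP hi hj hij h0 h1 h2 h3) ?_
        have := relSign_square hP hj hi hij.symm h0 h2 h1 (by rwa [insert_comm])
        rwa [insert_comm] at this
      · have hedge : IsEdge O.M (cubeVertex (symmDiff P S))
            (cubeVertex (symmDiff P (insert i (insert j S)))) := by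
          have := isEdge_two (M := O.M) (P := symmDiff P S) hij (b0.1 h0)
          rw [symmDiff_assoc, symmDiff_assoc, symmDiff_assoc, symmDiff_pair_of_notMem hi hj,
            symmDiff_singleton_of_notMem hi, symmDiff_singleton_of_notMem hj] at this
          refine this (b3.1 h3) ?_
          rwa [← b1, ← b2, ← not_and_or]
        have key : ∀ a b c d : SignType, a = -d → ¬ (b ≠ 0 ∧ c ≠ 0) → a * d ≤ b * c := by
          decide
        exact key _ _ _ _ (relSign_eq_neg hP hi hj hij hedge) h12
    · by_cases h12 : relSign O P (insert i S) ≠ 0 ∧ relSign O P (insert j S) ≠ 0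
      · obtain ⟨h1, h2⟩ := h12
        have hedge : IsEdge O.M (cubeVertex (symmDiff P (insert j S)))
            (cubeVertex (symmDiff P (insert i S))) := by
          have := isEdge_two (M := O.M) (P := symmDiff P (insert j S)) hij (b2.1 h2)
          have hiS : i ∉ insert j S := by simp [hij, hi]
          have ej : symmDiff (insert j S) {j} = S := by
            rw [← symmDiff_singleton_of_notMem hj, symmDiff_symmDiff_cancel_right]
          rw [symmDiff_assoc, symmDiff_assoc, symmDiff_assoc, symmDiff_insert_pair hi hj hij,
            symmDiff_singleton_of_notMem hiS, ej] at this
          refine this (b1.1 h1) ?_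
          rw [← b0, ← b3, ← not_and_or]
          exact fun h => h03 h.symm
        have key : ∀ a b c d : SignType, c = b → ¬ (a ≠ 0 ∧ d ≠ 0) → a * d ≤ b * c := by
          decide
        exact key _ _ _ _ (relSign_eq hP hi hj hij hedge) h03
      · have key : ∀ a b c d : SignType, ¬ (a ≠ 0 ∧ d ≠ 0) → ¬ (b ≠ 0 ∧ c ≠ 0) →
          a * d ≤ b * c := by decide
        exact key _ _ _ _ h03 h12

/-- Along an edge that does not descend, an index function counts the sign change. -/
theorem potential_step (hP : cubeVertex P ∈ O.M.bases) {ν : Finset (Fin n) → ℕ}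
    (hν : IsIndexFunction (relSign O P) ν)
    {S T : Finset (Fin n)} (hST : S.card ≤ T.card)
    (h : IsEdge O.M (cubeVertex (symmDiff P S)) (cubeVertex (symmDiff P T))) :
    ν T = ν S + if relSign O P S ≠ relSign O P T then 1 else 0 := by
  have hS : relSign O P S ≠ 0 := (relSign_ne_zero_iff hP).2 (h.2.1 (by simp))
  have hT : relSign O P T ≠ 0 := (relSign_ne_zero_iff hP).2 (h.2.1 (by simp))
  obtain ⟨i, j, hij⟩ : ∃ i j, T = symmDiff S {i, j} := by
    have e : symmDiff P T = symmDiff (symmDiff P S) (symmDiff S T) := by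
      rw [symmDiff_assoc, symmDiff_symmDiff_cancel_left]
    rw [e] at h
    obtain ⟨i, j, hij⟩ := h.eq_singleton_or_pair
    exact ⟨i, j, by rw [← hij, symmDiff_symmDiff_cancel_left]⟩
  -- a step exchanging an element of `S` for one outside is horizontal
  have hor : ∀ i j, i ∉ S → j ∈ S → T = symmDiff S {i, j} →
      ν T = ν S + if relSign O P S ≠ relSign O P T then 1 else 0 := by
    rintro i j hi hj rfl
    obtain ⟨R, hjR, rfl⟩ : ∃ R, j ∉ R ∧ insert j R = S := ⟨S.erase j, by simp, insert_erase hj⟩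
    have hij : i ≠ j := by rintro rfl; exact hi hj
    have hiR : i ∉ R := fun h => hi (mem_insert_of_mem h)
    rw [symmDiff_insert_pair hiR hjR hij] at h hT ⊢
    have hs := relSign_eq hP hiR hjR hij h
    rw [hν.horizontal R i j hiR hjR hij hT hs.symm, if_neg (not_not.2 hs), add_zero]
  by_cases hi : i ∈ S <;> by_cases hj : j ∈ S
  · exfalso
    have hsub : ({i, j} : Finset (Fin n)) ⊆ S := by simp [insert_subset_iff, hi, hj]
    rw [hij, symmDiff_of_ge hsub] at hST
    exact absurd (card_lt_card (sdiff_ssubset hsub (by simp))) (not_lt.2 hST)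
  · exact hor j i hj hi (by rw [hij, pair_comm])
  · exact hor i j hi hj hij
  · rw [symmDiff_pair_of_notMem hi hj] at hij
    subst hij
    by_cases hij : i = j
    · subst hij
      rw [insert_idem] at hT ⊢
      exact hν.insert_one S i hi hS hT
    · have hs := relSign_eq_neg hP hi hj hij h
      have key : ∀ a b : SignType, b ≠ 0 → a = -b → a ≠ b := by decide
      rw [hν.insert_two S i j hi hj hij hS hT hs, if_pos (key _ _ hT hs)]

/-- While the height is not maximal, there is an edge along which it strictly increases. Such edges
increase every functional `L` that is, on cube vertices, an increasing function of the height. -/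
theorem exists_increasing_path (hP : cubeVertex P ∈ O.M.bases) {L : (Fin n → ℝ) →ₗ[ℝ] ℝ}
    {c : ℝ} (hL : ∀ T, L (point (cubeVertex (symmDiff P T))) = c + 2 * T.card)
    {S : Finset (Fin n)} (hS : cubeVertex (symmDiff P S) ∈ O.M.bases) :
    ∃ ω, IsMaxHeight O.M (cubeVertex P) ω ∧ ∃ (m : ℕ) (v : Fin (m + 1) → Finset (J n)),
      (∀ i, v i ∈ O.M.bases) ∧ v 0 = cubeVertex (symmDiff P S) ∧ v (Fin.last m) = ω ∧
      (∀ i : Fin m, IsEdge O.M (v i.castSucc) (v i.succ)) ∧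
      ∀ i : Fin m, L (point (v i.castSucc)) < L (point (v i.succ)) := by
  induction hd : n - S.card using Nat.strong_induction_on generalizing S with
  | _ d ih =>
  by_cases hmax : IsMaxHeight O.M (cubeVertex P) (cubeVertex (symmDiff P S))
  · exact ⟨_, hmax, 0, fun _ => cubeVertex (symmDiff P S), fun _ => hS, rfl, rfl,
      fun i => i.elim0, fun i => i.elim0⟩
  obtain ⟨T, hT, hlt, hedge⟩ : ∃ T, cubeVertex (symmDiff P T) ∈ O.M.bases ∧ S.card < T.card ∧
      IsEdge O.M (cubeVertex (symmDiff P S)) (cubeVertex (symmDiff P T)) := by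
    obtain ⟨B, hB, hlt⟩ : ∃ B ∈ O.M.bases, height (cubeVertex P) (cubeVertex (symmDiff P S)) <
        height (cubeVertex P) B := by
      by_contra! h
      exact hmax ⟨hS, h⟩
    obtain ⟨T, rfl⟩ := exists_eq_cubeVertex_symmDiff hB P
    rw [height_cubeVertex_symmDiff, height_cubeVertex_symmDiff] at hlt
    obtain ⟨i, j, hi, hj, hne⟩ := (isOrientedDelta_relSign hP).exists_augment
      ((relSign_ne_zero_iff hP).2 hS) ((relSign_ne_zero_iff hP).2 hB) hlt
    rw [relSign_ne_zero_iff hP] at hne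
    have one : ∀ k, k ∉ S → cubeVertex (symmDiff P (insert k S)) ∈ O.M.bases →
        ∃ T, cubeVertex (symmDiff P T) ∈ O.M.bases ∧ S.card < T.card ∧
          IsEdge O.M (cubeVertex (symmDiff P S)) (cubeVertex (symmDiff P T)) := by
      intro k hk hb
      refine ⟨insert k S, hb, by simp [card_insert_of_notMem hk], ?_⟩
      rw [← symmDiff_singleton_of_notMem hk, ← symmDiff_assoc] at hb ⊢
      exact isEdge_one hS hb
    by_cases hij : i = j
    · subst hij
      exact one i hi (by rwa [insert_idem] at hne)
    by_cases hi' : cubeVertex (symmDiff P (insert i S)) ∈ O.M.bases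
    · exact one i hi hi'
    refine ⟨_, hne, ?_, ?_⟩
    · rw [card_insert_of_notMem (by simp [hij, hi]), card_insert_of_notMem hj]
      omega
    · rw [← symmDiff_singleton_of_notMem hi, ← symmDiff_assoc] at hi'
      rw [← symmDiff_pair_of_notMem hi hj, ← symmDiff_assoc] at hne ⊢
      exact isEdge_two hij hS hne (Or.inl hi')
  have hTn : T.card ≤ n := by simpa using card_le_univ T
  obtain ⟨ω, hω, m, v, hv, hv0, hvl, hve, hvL⟩ := ih (n - T.card) (by omega) hT rfl
  refine ⟨ω, hω, m + 1, Fin.cons (cubeVertex (symmDiff P S)) v, ?_, rfl, ?_, ?_, ?_⟩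
  · exact Fin.cases hS hv
  · rw [← Fin.succ_last, Fin.cons_succ, hvl]
  · refine Fin.cases ?_ fun i => ?_
    · simpa [hv0] using hedge
    · simpa [← Fin.succ_castSucc] using hve i
  · refine Fin.cases ?_ fun i => ?_
    · have : (S.card : ℝ) < T.card := by exact_mod_cast hlt
      simp [hv0, hL, this]
    · simpa [← Fin.succ_castSucc] using hvL i

theorem sum_succ_sub_castSucc (m : ℕ) (a : Fin (m + 1) → ℤ) :
    ∑ i : Fin m, (a i.succ - a i.castSucc) = a (Fin.last m) - a 0 := by
  have h1 := Fin.sum_univ_succ a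
  have h2 := Fin.sum_univ_castSucc a
  rw [sum_sub_distrib]
  linarith

/-- Sign changes along an increasing path telescope. The functional of the path enters only through
compatibility: the height never decreases along the path. -/
theorem signChanges_add {ν : Finset (Fin n) → ℕ}
    (hν : ∀ S T, S.card ≤ T.card →
      IsEdge O.M (cubeVertex (symmDiff P S)) (cubeVertex (symmDiff P T)) →
      ν T = ν S + if relSign O P S ≠ relSign O P T then 1 else 0)
    {A B : Finset (Fin n)} (p : IncreasingPath O.M (cubeVertex P) (cubeVertex (symmDiff P A))
      (cubeVertex (symmDiff P B))) :
    ν A + p.signChanges (O.s (cubeVertex P)) = ν B := by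
  choose S hS using fun i => exists_eq_cubeVertex_symmDiff (p.mem_bases i) P
  obtain ⟨L, hLc, hL⟩ := p.increasing
  have hstep : ∀ i : Fin p.length, ((if O.s (cubeVertex P) (p.vertex i.castSucc) ≠
      O.s (cubeVertex P) (p.vertex i.succ) then 1 else 0 : ℕ) : ℤ) =
      (ν (S i.succ) : ℤ) - ν (S i.castSucc) := by
    intro i
    have hcard : (S i.castSucc).card ≤ (S i.succ).card := by
      by_contra! h
      have := hLc _ (p.mem_bases i.castSucc) _ (p.mem_bases i.succ) (by
        rwa [hS i.castSucc, hS i.succ, height_cubeVertex_symmDiff, height_cubeVertex_symmDiff])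
      exact absurd this (not_lt.2 (hL i).le)
    have hedge := p.edge i
    rw [hS i.castSucc, hS i.succ] at hedge
    have h1 := hν _ _ hcard hedge
    rw [hS i.castSucc, hS i.succ, h1, Nat.cast_add, add_sub_cancel_left]
    rfl
  have h0 : S 0 = A := by
    rw [← cubeVertex_symmDiff_inj (P := P), ← hS, p.first]
  have hl : S (Fin.last _) = B := by
    rw [← cubeVertex_symmDiff_inj (P := P), ← hS, p.last]
  have hsum := sum_succ_sub_castSucc p.length fun i => (ν (S i) : ℤ)
  rw [h0, hl] at hsum
  have : (p.signChanges (O.s (cubeVertex P)) : ℤ) = ν B - ν A := by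
    rw [IncreasingPath.signChanges, card_filter, Nat.cast_sum, ← hsum]
    exact sum_congr rfl fun i _ => hstep i
  omega

theorem isMaxHeight_iff (hP : cubeVertex P ∈ O.M.bases) {S : Finset (Fin n)} :
    IsMaxHeight O.M (cubeVertex P) (cubeVertex (symmDiff P S)) ↔
      relSign O P S ≠ 0 ∧ ∀ T, relSign O P T ≠ 0 → T.card ≤ S.card := by
  simp only [IsMaxHeight, relSign_ne_zero_iff hP]
  refine and_congr_right fun _ => ⟨fun h T hT => ?_, fun h A hA => ?_⟩
  · simpa [height_cubeVertex_symmDiff] using h _ hT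
  · obtain ⟨T, rfl⟩ := exists_eq_cubeVertex_symmDiff hA P
    simpa [height_cubeVertex_symmDiff] using h T hA

end Relative
end LagMat

/-- The index of an oriented Lagrangian matroid relative to a fundamental basis `F` is
well defined. -/
theorem mainTheorem2 {n : ℕ} (O : LagMat.OrientedLagrangianMatroid n)
    (F : Finset (LagMat.J n)) (hF : F ∈ O.M.bases) :
    ∃ k : ℕ,
      (∃ ω : Finset (LagMat.J n), LagMat.IsMaxHeight O.M F ω ∧
        Nonempty (LagMat.IncreasingPath O.M F F ω)) ∧
      ∀ ω : Finset (LagMat.J n), LagMat.IsMaxHeight O.M F ω →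
        ∀ p : LagMat.IncreasingPath O.M F F ω, p.signChanges (O.s F) = k := by
  open LagMat in
  obtain ⟨P, rfl⟩ := exists_eq_cubeVertex (O.M.admissible F hF) (O.M.card_eq F hF)
  have hself : symmDiff P ∅ = P := symmDiff_bot P
  have hδ := isOrientedDelta_relSign hF
  obtain ⟨ν, hν⟩ := hδ.exists_index (by rwa [relSign_ne_zero_iff hF, hself])
  have hsteps : ∀ S T : Finset (Fin n), S.card ≤ T.card → _ → _ := fun S T hST h =>
    potential_step hF hν hST h
  -- weights `-1`: this functional is, up to constants, the height
  obtain ⟨L, hL⟩ := exists_functional P fun _ => -1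
  have hL' : ∀ T : Finset (Fin n), (L : (Fin n → ℝ) →ₗ[ℝ] ℝ)
      (point (cubeVertex (symmDiff P T))) = L (point (cubeVertex P)) + 2 * T.card := by
    intro T
    rw [ContinuousLinearMap.coe_coe, hL]
    simp
  obtain ⟨ω, hω, m, v, hv, hv0, hvl, hve, hvL⟩ :=
    exists_increasing_path hF hL' (S := ∅) (by rwa [hself])
  obtain ⟨B, rfl⟩ := exists_eq_cubeVertex_symmDiff hω.1 P
  -- the truncated subtraction is harmless: `signChanges_add` gives `ν ∅ ≤ ν B`
  refine ⟨ν B - ν ∅, ⟨_, hω, ⟨⟨m, v, hv, by rw [hv0, hself], hvl, hve, _, ?_, hvL⟩⟩⟩, ?_⟩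
  · intro A hA A' hA' hlt
    obtain ⟨S, rfl⟩ := exists_eq_cubeVertex_symmDiff hA P
    obtain ⟨S', rfl⟩ := exists_eq_cubeVertex_symmDiff hA' P
    rw [height_cubeVertex_symmDiff, height_cubeVertex_symmDiff] at hlt
    have : (S'.card : ℝ) < S.card := by exact_mod_cast hlt
    rw [hL', hL']
    linarith
  · intro ω' hω' p
    obtain ⟨B', rfl⟩ := exists_eq_cubeVertex_symmDiff hω'.1 P
    rw [isMaxHeight_iff hF] at hω hω'
    have hBB : ν B' = ν B := hδ.eq_of_card_maximal hν hω'.1 hω.1 hω'.2 hω.2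
    obtain ⟨q, hq⟩ : ∃ q : IncreasingPath O.M (cubeVertex P) (cubeVertex (symmDiff P ∅))
        (cubeVertex (symmDiff P B')), q.signChanges (O.s (cubeVertex P)) =
          p.signChanges (O.s (cubeVertex P)) := by
      rw [hself]; exact ⟨p, rfl⟩
    have := signChanges_add hsteps q
    omega
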